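/- Metric spaces are nonempty. Let $\mathbb R^+=[0,\infty)$, let $\mathbb U$ be the Urysohn space, and let $F(\mathbb U)$ be the set of nonempty closed subsets of $\mathbb U$ with the Effros Borel structure (generated by the sets $\{C\in F(\mathbb U) : C\cap V\neq\emptyset\}$ for $V\subseteq\mathbb U$ open); up to isometry the elements of $F(\mathbb U)$ are exactly the Polish metric spaces. For $C\in F(\mathbb U)$ let $D(C)=\{d(x,y): x,y\in C\}$. For $A\subseteq\mathbb R^+$ put $\mathcal V_A=\{C\in F(\mathbb U): D(C)\subseteq A\}$ and $\mathcal V_A^\star=\{C\in F(\mathbb U): D(C)=A\}$, both with the Borel structure induced from $F(\mathbb U)$. Let $\cong_A$ and $\sqsubseteq_A$ (respectively $\cong_A^\star$ and $\sqsubseteq_A^\star$) denote the relations of isometry and of isometric embeddability restricted to $\mathcal V_A$ (respectively to $\mathcal V_A^\star$). The set $A$ is called realizable if $\mathcal V_A^\star\neq\emptyset$. For binary relations $R$ on $X$ and $S$ on $Y$, where $X$ and $Y$ carry Borel structures, $R\leq_B S$ means that there is a Borel map $f\colon X\to Y$ such that $x\mathrel R x'\iff f(x)\mathrel S f(x')$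 for all $x,x'\in X$. Let $A,A'\subseteq\mathbb R^+$ be realizable. If $A\subsetneq A'$, then $$\cong_A^\star\;\leq_B\;\cong_A\;\leq_B\;\cong_{A'}^\star\;\leq_B\;\cong_{A'}\qquad\text{and}\qquad \sqsubseteq_A^\star\;\leq_B\;\sqsubseteq_A\;\leq_B\;\sqsubseteq_{A'}^\star\;\leq_B\;\sqsubseteq_{A'}.$$ In particular (answering the first part of a question of Clemens), if $A\subseteq A'$, then $\cong_A^\star\;\leq_B\;\cong_{A'}^\star$. -/

import Mathlib

open scoped NNReal

/-! ## The Urysohn space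

We build the Urysohn space as the completion of a countable pseudometric space. The latter is
obtained by recursively declaring the distances from the natural number `n` to the other points,
so that every one-point extension problem with rational data is eventually solved. -/

namespace UrysohnSpace

/-- A finite set `l` of pairs (point, rational number) is an admissible request for `d` if it is
nonempty and the prescribed numbers satisfy the triangle inequality `d p q ≤ p.2 + q.2`. -/
def Valid (d : ℕ → ℕ → ℝ) (l : Finset (ℕ × ℚ)) : Prop :=
  l.Nonempty ∧ ∀ p ∈ l, ∀ q ∈ l, d p.1 q.1 ≤ (p.2 : ℝ) + (q.2 : ℝ)

open Classical in
/-- The distances of a new point that answers the request `l` (a copy of the point `0` if the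
request is not admissible). -/
noncomputable def ext (d : ℕ → ℕ → ℝ) (l : Finset (ℕ × ℚ)) (m : ℕ) : ℝ :=
  if h : Valid d l then l.inf' h.1 (fun p => (p.2 : ℝ) + d p.1 m) else d 0 m

/-- Redefine the distances from the point `n`. -/
def step (d : ℕ → ℕ → ℝ) (f : ℕ → ℝ) (n i j : ℕ) : ℝ :=
  if i = n then (if j = n then 0 else f j) else (if j = n then f i else d i j)

/-- An enumeration of all requests in which each one occurs infinitely often. -/
def task (n : ℕ) : Finset (ℕ × ℚ) :=
  (Encodable.decode (α := Finset (ℕ × ℚ)) n.unpair.1).getD ∅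

/-- The successive approximations to the distance on `ℕ`. -/
noncomputable def dseq : ℕ → ℕ → ℕ → ℝ
  | 0 => fun _ _ => 0
  | n + 1 => step (dseq n) (ext (dseq n) (task n)) n

/-- The final distance on `ℕ`. -/
noncomputable def preDist (i j : ℕ) : ℝ := dseq (i + j + 1) i j

structure IsPseudo (d : ℕ → ℕ → ℝ) : Prop where
  self : ∀ i, d i i = 0
  symm : ∀ i j, d i j = d j i
  tri : ∀ i j k, d i k ≤ d i j + d j k

theorem ext_katetov {d : ℕ → ℕ → ℝ} (hd : IsPseudo d) (l : Finset (ℕ × ℚ)) (i j : ℕ) :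
    ext d l i ≤ ext d l j + d i j ∧ d i j ≤ ext d l i + ext d l j := by
  unfold ext
  split_ifs with h
  · obtain ⟨p, hp, hpe⟩ := Finset.exists_mem_eq_inf' h.1 (fun p => (p.2 : ℝ) + d p.1 i)
    obtain ⟨q, hq, hqe⟩ := Finset.exists_mem_eq_inf' h.1 (fun p => (p.2 : ℝ) + d p.1 j)
    constructor
    · have h1 := Finset.inf'_le (fun p : ℕ × ℚ => (p.2 : ℝ) + d p.1 i) hq
      have h2 := hd.tri q.1 j i
      have h3 := hd.symm i j
      linarith
    · have h1 := h.2 p hp q hq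
      have h2 := hd.tri i p.1 j
      have h3 := hd.tri p.1 q.1 j
      have h4 := hd.symm i p.1
      linarith
  · have h1 := hd.tri 0 j i
    have h2 := hd.tri i 0 j
    have h3 := hd.symm i j
    have h4 := hd.symm i 0
    constructor <;> linarith

theorem isPseudo_step {d : ℕ → ℕ → ℝ} (hd : IsPseudo d) {f : ℕ → ℝ}
    (hf : ∀ i j, f i ≤ f j + d i j ∧ d i j ≤ f i + f j) (n : ℕ) : IsPseudo (step d f n) := by
  have h0 : ∀ i, 0 ≤ f i := fun i => by
    have := (hf i i).2
    have := hd.self i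
    linarith
  refine ⟨fun i => ?_, fun i j => ?_, fun i j k => ?_⟩
  · unfold step
    split_ifs <;> simp [hd.self]
  · unfold step
    split_ifs <;> simp [hd.symm i j]
  · have h1 := hd.tri i j k
    have h2 := hf i j
    have h3 := hf j k
    have h4 := hf i k
    have h5 := h0 i
    have h6 := h0 j
    have h7 := h0 k
    have h8 := hd.symm j k
    have h9 := hf k j
    unfold step
    split_ifs <;> linarith

theorem isPseudo_dseq (n : ℕ) : IsPseudo (dseq n) := by
  induction n with
  | zero => exact ⟨fun _ => rfl, fun _ _ => rfl, fun _ _ _ => by simp [dseq]⟩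
  | succ n ih => exact isPseudo_step ih (ext_katetov ih _) n

theorem dseq_stable {n m : ℕ} (h : n ≤ m) {i j : ℕ} (hi : i < n) (hj : j < n) :
    dseq m i j = dseq n i j := by
  induction m, h using Nat.le_induction with
  | base => rfl
  | succ m hm ih =>
    rw [← ih, dseq, step, if_neg (by omega), if_neg (by omega)]

theorem preDist_eq {n i j : ℕ} (hi : i < n) (hj : j < n) : preDist i j = dseq n i j := by
  unfold preDist
  rw [← dseq_stable (le_max_left (i + j + 1) n) (by omega) (by omega),
    ← dseq_stable (le_max_right (i + j + 1) n) hi hj]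

theorem isPseudo_preDist : IsPseudo preDist := by
  refine ⟨fun i => (isPseudo_dseq _).self i, fun i j => ?_, fun i j k => ?_⟩
  · rw [preDist_eq (n := i + j + 1) (by omega) (by omega),
      preDist_eq (n := i + j + 1) (by omega) (by omega)]
    exact (isPseudo_dseq _).symm i j
  · rw [preDist_eq (n := i + j + k + 1) (i := i) (j := k) (by omega) (by omega),
      preDist_eq (n := i + j + k + 1) (i := i) (j := j) (by omega) (by omega),
      preDist_eq (n := i + j + k + 1) (i := j) (j := k) (by omega) (by omega)]
    exact (isPseudo_dseq _).tri i j k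

theorem preDist_realize (l : Finset (ℕ × ℚ)) (hl : Valid preDist l) :
    ∃ n : ℕ, ∀ m : ℕ, (∃ q : ℚ, (m, q) ∈ l) →
      preDist n m = l.inf' hl.1 (fun p => (p.2 : ℝ) + preDist p.1 m) := by
  obtain ⟨N, hN⟩ : ∃ N, ∀ p ∈ l, p.1 < N :=
    ⟨l.sup Prod.fst + 1, fun p hp => Nat.lt_succ_of_le (Finset.le_sup (f := Prod.fst) hp)⟩
  set n := Nat.pair (Encodable.encode l) N with hn
  have hNn : N ≤ n := Nat.right_le_pair _ _
  have ht : task n = l := by simp [task, hn]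
  have hlt : ∀ p ∈ l, p.1 < n := fun p hp => (hN p hp).trans_le hNn
  have hv : Valid (dseq n) l := by
    refine ⟨hl.1, fun p hp q hq => ?_⟩
    rw [← preDist_eq (hlt p hp) (hlt q hq)]
    exact hl.2 p hp q hq
  refine ⟨n, ?_⟩
  rintro m ⟨q, hq⟩
  have hm : m < n := hlt _ hq
  rw [preDist_eq (n := n + 1) (by omega) (by omega), dseq, step, if_pos rfl, if_neg (by omega), ht,
    ext, dif_pos hv]
  refine Finset.inf'_congr _ rfl (fun p hp => ?_)
  rw [preDist_eq (hlt p hp) hm]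

/-- The natural numbers with the pseudometric `preDist`. -/
def Pre : Type := ℕ

noncomputable instance : PseudoMetricSpace Pre where
  dist i j := preDist i j
  dist_self := isPseudo_preDist.self
  dist_comm := isPseudo_preDist.symm
  dist_triangle := isPseudo_preDist.tri

instance : Countable Pre := inferInstanceAs (Countable ℕ)

instance : Nonempty Pre := inferInstanceAs (Nonempty ℕ)

end UrysohnSpace

/-- The Urysohn space: `isUrysohn_urysohn` shows that it satisfies the properties that determine
it up to isometry. -/
abbrev Urysohn : Type := UniformSpace.Completion UrysohnSpace.Pre

/-- The properties that characterize the Urysohn space up to isometry: it is complete and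
separable, and each function on a finite subset that is a possible distance function to one
further point (a Katetov function) is the distance function to some point of the space. -/
structure IsUrysohn (U : Type*) [MetricSpace U] : Prop where
  complete : CompleteSpace U
  separable : TopologicalSpace.SeparableSpace U
  extension : ∀ (s : Finset U) (f : U → ℝ),
    (∀ x ∈ s, ∀ y ∈ s, |f x - f y| ≤ dist x y ∧ dist x y ≤ f x + f y) →
      ∃ z : U, ∀ x ∈ s, dist z x = f x

namespace UrysohnSpace

theorem approx (s : Finset Urysohn) (f : Urysohn → ℝ)
    (hf : ∀ x ∈ s, ∀ y ∈ s, |f x - f y| ≤ dist x y ∧ dist x y ≤ f x + f y)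
    {ε : ℝ} (hε : 0 < ε) : ∃ z : Urysohn, ∀ x ∈ s, |dist z x - f x| ≤ ε := by
  classical
  rcases s.eq_empty_or_nonempty with rfl | hs
  · exact ⟨((Classical.arbitrary Pre : Pre) : Urysohn), by simp⟩
  obtain ⟨δ, hδ, hδε⟩ : ∃ δ : ℝ, 0 < δ ∧ 4 * δ ≤ ε := ⟨ε / 4, by positivity, by linarith⟩
  have hn : ∀ x : Urysohn, ∃ n : Pre, dist x (n : Urysohn) < δ := fun x =>
    Metric.denseRange_iff.1 UniformSpace.Completion.denseRange_coe x δ hδ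
  choose n hn using hn
  have hq : ∀ x : Urysohn, ∃ q : ℚ, f x + 2 * δ < q ∧ (q : ℝ) < f x + 3 * δ := fun x =>
    exists_rat_btwn (by linarith)
  choose q hq1 hq2 using hq
  have hd : ∀ x y : Urysohn, |preDist (n x) (n y) - dist x y| ≤ 2 * δ := fun x y => by
    have h : preDist (n x) (n y) = dist ((n x : Pre) : Urysohn) ((n y : Pre) : Urysohn) :=
      (UniformSpace.Completion.dist_eq (n x) (n y)).symm
    have h1 := dist_triangle4 x (n x : Urysohn) (n y : Urysohn) y
    have h2 := dist_triangle4 (n x : Urysohn) x y (n y : Urysohn)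
    have h3 := hn x
    have h4 := hn y
    rw [dist_comm] at h3
    rw [h, abs_le]
    rw [dist_comm x (n x : Urysohn)] at h1
    rw [dist_comm (n y : Urysohn) y] at h1
    constructor <;> linarith
  set l : Finset (ℕ × ℚ) := s.image (fun x => ((n x : ℕ), q x)) with hl
  have hv : Valid preDist l := by
    refine ⟨hs.image _, ?_⟩
    simp only [hl, Finset.forall_mem_image]
    intro x hx y hy
    have h1 := (abs_le.1 (hd x y)).2
    have h2 := (hf x hx y hy).2
    have h3 := hq1 x
    have h4 := hq1 y
    linarith
  have hmem : ∀ x ∈ s, ((n x, q x) : ℕ × ℚ) ∈ l := fun x hx => Finset.mem_image.2 ⟨x, hx, rfl⟩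
  obtain ⟨N, hN⟩ : ∃ N : Pre, ∀ m : ℕ, (∃ q : ℚ, (m, q) ∈ l) →
      preDist N m = l.inf' hv.1 (fun p => (p.2 : ℝ) + preDist p.1 m) := preDist_realize l hv
  refine ⟨((N : Pre) : Urysohn), fun x hx => ?_⟩
  have h1 := hN (n x) ⟨q x, hmem x hx⟩
  have h2 : dist ((N : Pre) : Urysohn) ((n x : Pre) : Urysohn) = preDist N (n x) :=
    UniformSpace.Completion.dist_eq (α := Pre) N (n x)
  have h3 : preDist N (n x) ≤ f x + 3 * δ := by
    rw [h1]
    refine (Finset.inf'_le (fun p : ℕ × ℚ => (p.2 : ℝ) + preDist p.1 (n x))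
      (hmem x hx)).trans ?_
    have := isPseudo_preDist.self (n x)
    have := hq2 x
    simp only
    linarith
  have h4 : f x ≤ preDist N (n x) := by
    rw [h1]
    refine Finset.le_inf' _ _ ?_
    simp only [hl, Finset.forall_mem_image]
    intro y hy
    have h5 := (abs_le.1 (hd y x)).1
    have h6 := (abs_le.1 (hf y hy x hx).1).1
    have h7 := hq1 y
    linarith
  have h5 := dist_triangle ((N : Pre) : Urysohn) ((n x : Pre) : Urysohn) x
  have h6 := dist_triangle ((N : Pre) : Urysohn) x ((n x : Pre) : Urysohn)
  have h7 := hn x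
  rw [dist_comm ((n x : Pre) : Urysohn) x] at h5
  rw [abs_le]
  constructor <;> linarith

theorem improve (s : Finset Urysohn) (f : Urysohn → ℝ)
    (hf : ∀ x ∈ s, ∀ y ∈ s, |f x - f y| ≤ dist x y ∧ dist x y ≤ f x + f y)
    {ε : ℝ} (hε : 0 < ε) (z : Urysohn) (hz : ∀ x ∈ s, |dist z x - f x| ≤ ε) :
    ∃ z' : Urysohn, (∀ x ∈ s, |dist z' x - f x| ≤ ε / 2) ∧ dist z z' ≤ 2 * ε := by
  classical
  by_cases hzs : z ∈ s
  · obtain ⟨z', hz'⟩ := approx s f hf (half_pos hε)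
    refine ⟨z', hz', ?_⟩
    have h1 := abs_le.1 (hz z hzs)
    have h2 := abs_le.1 (hz' z hzs)
    rw [dist_self] at h1
    rw [dist_comm]
    linarith
  rcases s.eq_empty_or_nonempty with rfl | hs
  · exact ⟨z, by simp, by simp [hε.le]⟩
  set c : ℝ := s.sup' hs (fun x => |dist z x - f x|) with hc
  have hc1 : ∀ x ∈ s, |dist z x - f x| ≤ c := fun x hx =>
    Finset.le_sup' (fun x => |dist z x - f x|) hx
  have hc2 : c ≤ ε := Finset.sup'_le _ _ hz
  have hc3 : ∀ x ∈ s, c ≤ f x + dist z x := fun x hx => by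
    refine Finset.sup'_le _ _ (fun y hy => ?_)
    have h1 := hf x hx y hy
    have h2 := abs_le.1 h1.1
    have h3 := dist_triangle z x y
    have h4 := dist_triangle_left x y z
    rw [abs_le]
    constructor <;> linarith
  have hc0 : 0 ≤ c := by
    obtain ⟨x, hx⟩ := hs
    exact (abs_nonneg _).trans (hc1 x hx)
  have hne : ∀ x ∈ s, x ≠ z := fun x hx h => hzs (h ▸ hx)
  obtain ⟨z', hz'⟩ := approx (insert z s) (fun w => if w = z then c else f w) (by
    intro x hx y hy
    rw [Finset.mem_insert] at hx hy
    rcases hx with rfl | hx <;> rcases hy with rfl | hy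
    · simp [hc0]
    · have h1 := abs_le.1 (hc1 y hy)
      have h2 := hc3 y hy
      rw [if_pos rfl, if_neg (hne y hy), abs_le]
      refine ⟨⟨?_, ?_⟩, ?_⟩ <;> linarith
    · have h1 := abs_le.1 (hc1 x hx)
      have h2 := hc3 x hx
      rw [if_pos rfl, if_neg (hne x hx), abs_le, dist_comm]
      refine ⟨⟨?_, ?_⟩, ?_⟩ <;> linarith
    · rw [if_neg (hne x hx), if_neg (hne y hy)]
      exact hf x hx y hy) (half_pos hε)
  refine ⟨z', fun x hx => ?_, ?_⟩
  · have := hz' x (Finset.mem_insert_of_mem hx)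
    rwa [if_neg (hne x hx)] at this
  · have := abs_le.1 (hz' z (Finset.mem_insert_self z s))
    rw [if_pos rfl] at this
    rw [dist_comm]
    linarith

end UrysohnSpace

theorem isUrysohn_urysohn : IsUrysohn Urysohn := by
  refine ⟨inferInstance, inferInstance, fun s f hf => ?_⟩
  obtain ⟨z0, hz0⟩ := UrysohnSpace.approx s f hf one_pos
  have hpos : ∀ n : ℕ, (0 : ℝ) < (1 / 2) ^ n := fun n => by positivity
  choose g hg1 hg2 using fun (n : ℕ) (z : {z : Urysohn // ∀ x ∈ s, |dist z x - f x| ≤ (1 / 2) ^ n}) =>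
    UrysohnSpace.improve s f hf (hpos n) z.1 z.2
  let u : ∀ n : ℕ, {z : Urysohn // ∀ x ∈ s, |dist z x - f x| ≤ (1 / 2) ^ n} := fun n =>
    Nat.rec ⟨z0, by simpa using hz0⟩
      (fun n z => ⟨g n z, fun x hx => (hg1 n z x hx).trans (by rw [pow_succ]; linarith)⟩) n
  have hu : ∀ n, dist (u n).1 (u (n + 1)).1 ≤ 2 * (1 / 2) ^ n := fun n => hg2 n (u n)
  obtain ⟨z, hz⟩ := cauchySeq_tendsto_of_complete
    (cauchySeq_of_le_geometric (1 / 2) 2 (by norm_num) hu)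
  refine ⟨z, fun x hx => ?_⟩
  have h1 : Filter.Tendsto (fun n => |dist (u n).1 x - f x|) Filter.atTop
      (nhds |dist z x - f x|) := ((hz.dist tendsto_const_nhds).sub_const _).abs
  have h2 : Filter.Tendsto (fun n : ℕ => ((1 : ℝ) / 2) ^ n) Filter.atTop (nhds 0) :=
    tendsto_pow_atTop_nhds_zero_of_lt_one (by norm_num) (by norm_num)
  have h3 := le_of_tendsto_of_tendsto' h1 h2 (fun n => (u n).2 x hx)
  exact sub_eq_zero.1 (abs_nonpos_iff.1 h3)

/-! ## Borel reducibility, and spaces with prescribed distances -/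

/-- `R` is Borel reducible to `S`. -/
def BorelReducible {X Y : Type*} [MeasurableSpace X] [MeasurableSpace Y]
    (R : X → X → Prop) (S : Y → Y → Prop) : Prop :=
  ∃ f : X → Y, Measurable f ∧ ∀ x x', R x x' ↔ S (f x) (f x')

/-- The nonempty closed subsets of a topological space. -/
structure NonemptyClosed (U : Type*) [TopologicalSpace U] where
  carrier : Set U
  isClosed : IsClosed carrier
  nonempty : carrier.Nonempty

/-- The Effros Borel structure: it is generated by the collections of those `C` that meet a given
open set. -/
instance (U : Type*) [TopologicalSpace U] : MeasurableSpace (NonemptyClosed U) :=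
  MeasurableSpace.generateFrom
    {S | ∃ V : Set U, IsOpen V ∧ S = {C : NonemptyClosed U | (C.carrier ∩ V).Nonempty}}

/-- The set of distances realized in a subset of a metric space. -/
def distanceSet {U : Type*} [MetricSpace U] (C : Set U) : Set ℝ≥0 :=
  {r | ∃ x ∈ C, ∃ y ∈ C, nndist x y = r}

/-- The Polish metric spaces, represented as nonempty closed subsets of the Urysohn space, all of
whose distances belong to `A`. As a subtype it carries the induced Borel structure. -/
def SpacesWithin (A : Set ℝ≥0) : Set (NonemptyClosed Urysohn) :=
  {C | distanceSet C.carrier ⊆ A}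

/-- The Polish metric spaces, represented as nonempty closed subsets of the Urysohn space, whose
set of distances is exactly `A`. -/
def SpacesExactly (A : Set ℝ≥0) : Set (NonemptyClosed Urysohn) :=
  {C | distanceSet C.carrier = A}

/-- `A` is the set of distances of some Polish metric space. -/
def Realizable (A : Set ℝ≥0) : Prop := (SpacesExactly A).Nonempty

/-- Two subspaces are isometric (through a surjective isometry). -/
def Isometric {U : Type*} [MetricSpace U] (C C' : NonemptyClosed U) : Prop :=
  Nonempty (C.carrier ≃ᵢ C'.carrier)

/-- The first subspace embeds isometrically into the second one. -/
def IsometricallyEmbeds {U : Type*} [MetricSpace U] (C C' : NonemptyClosed U) : Prop :=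
  ∃ f : C.carrier → C'.carrier, Isometry f

/-- Isometry on the spaces with distances in `A`. -/
def isomWithin (A : Set ℝ≥0) (C C' : SpacesWithin A) : Prop := Isometric C.1 C'.1

/-- Isometry on the spaces with distance set `A`. -/
def isomExactly (A : Set ℝ≥0) (C C' : SpacesExactly A) : Prop := Isometric C.1 C'.1

/-- Isometric embeddability on the spaces with distances in `A`. -/
def embWithin (A : Set ℝ≥0) (C C' : SpacesWithin A) : Prop := IsometricallyEmbeds C.1 C'.1

/-- Isometric embeddability on the spaces with distance set `A`. -/
def embExactly (A : Set ℝ≥0) (C C' : SpacesExactly A) : Prop := IsometricallyEmbeds C.1 C'.1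

/-! Fix `r` in `A'` but not in `A`; it is nonzero, since 0 is a distance in every nonempty space.
The reduction sends X to X × K with the maximum metric, where K is one fixed space with distance set
`A'`. A maximum of two distances is one of them, so X × K has distance set `A'` as well. The point
is to choose K so that X can be recovered from the product.

For this, K contains two marked points at distance `r`, every other point is at distance at least
`r` from both, and the other points do not realize `r` (`exists_markedPair`). An isometric embedding
of X × K into Y × K sends the two marked points over x to points at distance `r`. Since Y omits `r`,
the K-coordinates realize it, so one of them is marked. Projecting that image to Y embeds X
(`exists_fiber_isometry`): a displacement shorter than `r` cannot change a marked coordinate, and a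
distance above `r` between marked fibres is visible only in Y. If the given map is onto, so is the
resulting one (`nonempty_isometryEquiv`). -/

open Filter Topology TopologicalSpace

/-! ## Universality of the Urysohn space -/

/-- Recursively chosen points whose mutual distances copy those of the sequence `m`. -/
noncomputable def copySeq (U : Type*) {M : Type*} [MetricSpace U] [Nonempty U]
    [PseudoMetricSpace M] (m : ℕ → M) : ℕ → U
  | n => Classical.epsilon fun z : U => ∀ k : Fin n, dist z (copySeq U m k) = dist (m n) (m k)
decreasing_by exact k.2

/-- The distances from `m n` to the earlier terms form a Katetov function on the points already
placed, so the extension property makes the condition under `epsilon` satisfiable. -/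
theorem IsUrysohn.dist_copySeq {U M : Type*} [MetricSpace U] [Nonempty U] [PseudoMetricSpace M]
    (hU : IsUrysohn U) (m : ℕ → M) (n : ℕ) :
    ∀ k < n, dist (copySeq U m n) (copySeq U m k) = dist (m n) (m k) := by
  classical
  induction n using Nat.strong_induction_on with
  | _ n ih =>
    have hd : ∀ k < n, ∀ l < n, dist (copySeq U m k) (copySeq U m l) = dist (m k) (m l) := by
      intro k hk l hl
      rcases lt_trichotomy k l with h | rfl | h
      · rw [dist_comm, ih l hl k h, dist_comm]
      · simp
      · exact ih k hk l h
    obtain ⟨z, hz⟩ := hU.extension ((Finset.range n).image (copySeq U m))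
      (fun x => if h : ∃ k < n, copySeq U m k = x then dist (m n) (m h.choose) else 0) (by
        intro x hx y hy
        simp only [Finset.mem_image, Finset.mem_range] at hx hy
        rw [dif_pos hx, dif_pos hy]
        have h1 := hd _ hx.choose_spec.1 _ hy.choose_spec.1
        rw [hx.choose_spec.2, hy.choose_spec.2] at h1
        rw [h1, dist_comm (m n), dist_comm (m n)]
        exact ⟨abs_dist_sub_le _ _ _, dist_triangle_right _ _ _⟩)
    have key : ∃ z : U, ∀ k : Fin n, dist z (copySeq U m k) = dist (m n) (m k) := by
      refine ⟨z, fun k => ?_⟩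
      have hk : ∃ l < n, copySeq U m l = copySeq U m k := ⟨k, k.2, rfl⟩
      rw [hz _ (Finset.mem_image_of_mem _ (Finset.mem_range.2 k.2)), dif_pos hk]
      -- The chosen index may differ from `k` when a point is repeated, but then the two terms of
      -- `m` are at distance 0.
      have h0 : dist (m hk.choose) (m k) = 0 := by
        rw [← hd _ hk.choose_spec.1 _ k.2, hk.choose_spec.2, dist_self]
      have h1 := dist_triangle (m n) (m hk.choose) (m k)
      have h2 := dist_triangle_right (m n) (m hk.choose) (m k)
      linarith
    intro k hk
    rw [copySeq]
    exact Classical.epsilon_spec key ⟨k, hk⟩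

/-- Every separable pseudometric space maps isometrically into a Urysohn space. -/
theorem IsUrysohn.exists_isometry {U : Type*} [MetricSpace U] (hU : IsUrysohn U)
    (M : Type*) [PseudoMetricSpace M] [SeparableSpace M] : ∃ f : M → U, Isometry f := by
  have := hU.complete
  rcases isEmpty_or_nonempty M with hM | hM
  · exact ⟨fun x => isEmptyElim x, fun x => isEmptyElim x⟩
  have : Nonempty U := ⟨(hU.extension ∅ 0 (by simp)).choose⟩
  set m := denseSeq M
  have hd : ∀ k l, dist (copySeq U m k) (copySeq U m l) = dist (m k) (m l) := by
    intro k l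
    rcases lt_trichotomy k l with h | rfl | h
    · rw [dist_comm, hU.dist_copySeq m l k h, dist_comm]
    · simp
    · exact hU.dist_copySeq m k l h
  have ha : ∀ x : M, ∃ a : ℕ → ℕ, Tendsto (fun i => m (a i)) atTop (𝓝 x) := by
    intro x
    obtain ⟨v, hv, hvx⟩ := mem_closure_iff_seq_limit.1 (denseRange_denseSeq M x)
    choose a ha using hv
    exact ⟨a, by simpa only [m, ha] using hvx⟩
  choose a ha using ha
  have hc : ∀ x, ∃ u : U, Tendsto (fun i => copySeq U m (a x i)) atTop (𝓝 u) := by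
    intro x
    refine cauchySeq_tendsto_of_complete (Metric.cauchySeq_iff.2 fun ε hε => ?_)
    obtain ⟨N, hN⟩ := Metric.cauchySeq_iff.1 (ha x).cauchySeq ε hε
    exact ⟨N, fun i hi j hj => (hd _ _).trans_lt (hN i hi j hj)⟩
  choose f hf using hc
  refine ⟨f, Isometry.of_dist_eq fun x y => ?_⟩
  refine tendsto_nhds_unique ((hf x).dist (hf y)) ?_
  simp only [hd]
  exact (ha x).dist (ha y)

/-! ## Wedges of pointed spaces -/

/-- The points of copies of `U`, one for each `i`, glued at the base points `b i`. -/
def Wedge {ι U : Type*} (_b : ι → U) : Type _ := ι × U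

namespace Wedge

variable {ι U : Type*} [MetricSpace U] {b : ι → U}

open Classical in
/-- The wedge carries the maximum metric. -/
noncomputable instance : PseudoMetricSpace (Wedge b) where
  dist p q := if p.1 = q.1 then dist p.2 q.2 else max (dist p.2 (b p.1)) (dist q.2 (b q.1))
  dist_self p := by simp
  dist_comm p q := by
    simp only [eq_comm (a := p.1), dist_comm p.2 q.2, max_comm (dist p.2 (b p.1))]
  dist_triangle := by
    rintro ⟨i, x⟩ ⟨j, y⟩ ⟨k, z⟩
    have h1 := dist_triangle x y z
    have h2 := dist_triangle x y (b i)
    have h3 := dist_triangle_left y (b k) z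
    have h4 := dist_triangle_right x z (b i)
    have h5 : 0 ≤ dist x (b i) := dist_nonneg
    have h6 : 0 ≤ dist y (b j) := dist_nonneg
    have h7 : 0 ≤ dist z (b k) := dist_nonneg
    have h8 := dist_triangle z y (b k)
    have h9 := dist_comm y z
    simp only
    by_cases hij : i = j
    · subst hij
      by_cases hik : i = k
      · subst hik
        simpa using h1
      · simp only [if_neg hik, if_true]
        refine max_le ?_ ?_
        · linarith [le_max_left (dist y (b i)) (dist z (b k))]
        · linarith [le_max_right (dist y (b i)) (dist z (b k)), dist_nonneg (x := x) (y := y)]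
    · by_cases hik : i = k
      · subst hik
        simp only [if_neg hij, if_neg (Ne.symm hij), if_true]
        linarith [le_max_left (dist x (b i)) (dist y (b j)),
          le_max_right (dist y (b j)) (dist z (b i))]
      · by_cases hjk : j = k
        · subst hjk
          simp only [if_neg hij, if_true]
          refine max_le ?_ ?_
          · linarith [le_max_left (dist x (b i)) (dist y (b j)), dist_nonneg (x := y) (y := z)]
          · linarith [le_max_right (dist x (b i)) (dist y (b j))]
        · simp only [if_neg hij, if_neg hik, if_neg hjk]
          refine max_le ?_ ?_
          · linarith [le_max_left (dist x (b i)) (dist y (b j)),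
              le_max_right (dist y (b j)) (dist z (b k))]
          · linarith [le_max_left (dist x (b i)) (dist y (b j)),
              le_max_right (dist y (b j)) (dist z (b k))]

/-- The point `x` of the copy with index `i`. -/
def mk (b : ι → U) (i : ι) (x : U) : Wedge b := (i, x)

theorem dist_mk_same (i : ι) (x y : U) : dist (mk b i x) (mk b i y) = dist x y := if_pos rfl

theorem dist_mk_ne {i j : ι} (h : i ≠ j) (x y : U) :
    dist (mk b i x) (mk b j y) = max (dist x (b i)) (dist y (b j)) := if_neg h

theorem dist_mk_base (i j : ι) (x : U) : dist (mk b i x) (mk b j (b j)) = dist x (b i) := by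
  by_cases h : i = j
  · subst h
    exact dist_mk_same _ _ _
  · rw [dist_mk_ne h, dist_self, max_eq_left dist_nonneg]

theorem isometry_mk (i : ι) : Isometry (mk b i) := Isometry.of_dist_eq (dist_mk_same i)

instance [Countable ι] [SeparableSpace U] : SeparableSpace (Wedge b) := by
  have h : (Set.univ : Set (Wedge b)) = ⋃ i, Set.range (mk b i) := by
    ext p
    exact ⟨fun _ => Set.mem_iUnion.2 ⟨p.1, p.2, rfl⟩, fun _ => trivial⟩
  rw [← isSeparable_univ_iff, h]
  exact IsSeparable.iUnion fun i => isSeparable_range (isometry_mk i).continuous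

/-- The image of a wedge of complete spaces under an isometry is closed. -/
theorem isClosed_image {V : Type*} [MetricSpace V] [CompleteSpace U] {g : Wedge b → V}
    (hg : Isometry g) {P : ι → Set U} (hP : ∀ i, IsClosed (P i)) (hb : ∀ i, b i ∈ P i) :
    IsClosed {v | ∃ i, ∃ x ∈ P i, g (mk b i x) = v} := by
  refine IsSeqClosed.isClosed fun u y hu huy => ?_
  choose i x hx hgx using hu
  set o := g (mk b (i 0) (b (i 0)))
  by_cases hy : y = o
  · exact ⟨i 0, b (i 0), hb _, hy.symm⟩
  have hc : 0 < dist y o := dist_pos.2 hy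
  obtain ⟨N, hN⟩ := Metric.tendsto_atTop.1 huy (dist y o / 4) (by positivity)
  -- Points of different copies are at least as far apart as either is from the base point. Here
  -- that is more than 3/4 of `dist y o`, whereas late terms are within 1/2 of it, so they share a
  -- copy.
  have hi : ∀ n ≥ N, i n = i N := by
    intro n hn
    by_contra hne
    have h1 := hN n hn
    have h2 := hN N le_rfl
    have h3 := dist_mk_ne (b := b) hne (x n) (x N)
    have h4 : dist (u n) o = dist (x n) (b (i n)) := by
      rw [← hgx, hg.dist_eq, dist_mk_base]
    rw [← hg.dist_eq, hgx, hgx, ← h4] at h3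
    have h5 := le_max_left (dist (u n) o) (dist (x N) (b (i N)))
    have h6 := dist_triangle_left y o (u n)
    have h7 := dist_triangle_right (u n) (u N) y
    linarith
  have hu : ∀ n ≥ N, u n = g (mk b (i N) (x n)) := fun n hn => by rw [← hgx, hi n hn]
  have hcau : CauchySeq x := by
    refine Metric.cauchySeq_iff.2 fun ε hε => ?_
    obtain ⟨L, hL⟩ := Metric.cauchySeq_iff.1 huy.cauchySeq ε hε
    refine ⟨max N L, fun n hn k hk => ?_⟩
    have := hL n (le_of_max_le_right hn) k (le_of_max_le_right hk)
    rwa [hu n (le_of_max_le_left hn), hu k (le_of_max_le_left hk), hg.dist_eq,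
      dist_mk_same] at this
  obtain ⟨z, hz⟩ := cauchySeq_tendsto_of_complete hcau
  refine ⟨i N, z, (hP _).mem_of_tendsto hz ?_, ?_⟩
  · filter_upwards [eventually_ge_atTop N] with n hn
    exact hi n hn ▸ hx n
  · refine tendsto_nhds_unique ?_ huy
    refine ((hg.comp (isometry_mk (i N))).continuous.tendsto z |>.comp hz).congr' ?_
    filter_upwards [eventually_ge_atTop N] with n hn
    exact (hu n hn).symm

end Wedge

/-! ## A space with two marked points -/

/-- Two points `e true` and `e false` at distance `r`, such that all other points are at distance
at least `r` from them and do not realize the distance `r` among themselves. -/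
structure MarkedPair {K : Type*} [MetricSpace K] (r : ℝ) (e : Bool → K) : Prop where
  pos : 0 < r
  dist_eq : ∀ s t, s ≠ t → dist (e s) (e t) = r
  le_dist : ∀ p ∉ Set.range e, ∀ t, r ≤ dist p (e t)
  dist_ne : ∀ p ∉ Set.range e, ∀ q ∉ Set.range e, dist p q ≠ r

/-- If `r` is a nonzero distance in `C`, then the distance set of `C` is also the distance set of
a closed set in which `r` is realized in a controlled way. -/
theorem exists_markedPair (C : NonemptyClosed Urysohn) {r : ℝ≥0} (hr : r ≠ 0)
    (hrC : r ∈ distanceSet C.carrier) :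
    ∃ K : NonemptyClosed Urysohn, distanceSet K.carrier = distanceSet C.carrier ∧
      ∃ e : Bool → K.carrier, MarkedPair r e := by
  obtain ⟨a, ha, c, hc, hac⟩ := hrC
  have hac' : dist a c = r := by rw [← hac, coe_nndist]
  have hr0 : (0 : ℝ) < r := by positivity
  have : Nonempty C.carrier := C.nonempty.to_subtype
  let q : ℕ → Urysohn := fun n => denseSeq C.carrier n
  have hqC : ∀ n, q n ∈ C.carrier := fun n => (denseSeq C.carrier n).2
  have hq : ∀ x ∈ C.carrier, ∀ ε > 0, ∃ n, dist x (q n) < ε := fun x hx ε hε =>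
    Metric.denseRange_iff.1 (denseRange_denseSeq C.carrier) ⟨x, hx⟩ ε hε
  -- Pieces of `C` that omit `r` will supply all distances other than `r`. Balls around a dense
  -- sequence, rather than single pairs of points, keep the pieces countable in number and the wedge
  -- separable.
  let S : ℕ × ℕ × ℕ → Set Urysohn := fun k => C.carrier ∩
    (Metric.closedBall (q k.1) (1 / (k.2.2 + 1)) ∪ Metric.closedBall (q k.2.1) (1 / (k.2.2 + 1)))
  let I := {k : ℕ × ℕ × ℕ // ∀ x ∈ S k, ∀ y ∈ S k, dist x y ≠ r}
  let b : I ⊕ Bool → Urysohn := Sum.elim (fun k => q k.1.1) (fun _ => a)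
  -- The distance `r` comes from two further copies of `{a, c}` glued at `a`. The two copies of `c`
  -- are the marked points: their distance is max(r, r), and the base point is at distance `r` from
  -- both.
  let P : I ⊕ Bool → Set Urysohn := Sum.elim (fun k => S k.1) (fun _ => {a, c})
  have hP : ∀ i, IsClosed (P i) := by
    rintro (k | t)
    · exact C.isClosed.inter (Metric.isClosed_closedBall.union Metric.isClosed_closedBall)
    · exact (Set.toFinite {a, c}).isClosed
  have hb : ∀ i, b i ∈ P i := by
    rintro (k | t)
    · exact ⟨hqC _, Or.inl (Metric.mem_closedBall_self (by positivity))⟩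
    · exact Or.inl rfl
  have hPC : ∀ i, P i ⊆ C.carrier := by
    rintro (k | t)
    · exact Set.inter_subset_left
    · rintro x (rfl | rfl)
      exacts [ha, hc]
  have := isUrysohn_urysohn.separable
  obtain ⟨g, hg⟩ := isUrysohn_urysohn.exists_isometry (Wedge b)
  let E : Bool → Urysohn := fun t => g (Wedge.mk b (Sum.inr t) c)
  let K : NonemptyClosed Urysohn :=
    ⟨{v | ∃ i, ∃ x ∈ P i, g (Wedge.mk b i x) = v}, Wedge.isClosed_image hg hP hb,
      ⟨_, Sum.inr true, a, hb (Sum.inr true), rfl⟩⟩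
  have hEK : ∀ t, E t ∈ K.carrier := fun t => ⟨Sum.inr t, c, Or.inr rfl, rfl⟩
  have hEE : ∀ s t, s ≠ t → dist (E s) (E t) = r := by
    intro s t hst
    rw [hg.dist_eq, Wedge.dist_mk_ne (by simpa using hst)]
    simp [b, dist_comm c a, hac']
  refine ⟨K, ?_, fun t => ⟨E t, hEK t⟩, hr0, fun s t hst => hEE s t hst, ?_, ?_⟩
  · ext d
    constructor
    · rintro ⟨_, ⟨i, x, hx, rfl⟩, _, ⟨j, y, hy, rfl⟩, rfl⟩
      by_cases hij : i = j
      · subst hij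
        exact ⟨x, hPC _ hx, y, hPC _ hy, by ext; simp [hg.dist_eq, Wedge.dist_mk_same]⟩
      · rcases max_choice (dist x (b i)) (dist y (b j)) with h | h
        · exact ⟨x, hPC _ hx, b i, hPC _ (hb i), by
            ext; simp only [coe_nndist, hg.dist_eq, Wedge.dist_mk_ne hij, h]⟩
        · exact ⟨y, hPC _ hy, b j, hPC _ (hb j), by
            ext; simp only [coe_nndist, hg.dist_eq, Wedge.dist_mk_ne hij, h]⟩
    · rintro ⟨x, hx, y, hy, rfl⟩
      by_cases hxy : dist x y = r
      · exact ⟨_, hEK true, _, hEK false, by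
          ext; rw [coe_nndist, coe_nndist, hxy]; exact hEE _ _ (by simp)⟩
      have hpos : 0 < |dist x y - r| := abs_pos.2 (sub_ne_zero.2 hxy)
      -- Radius below `r / 2` excludes `r` within one ball. Radius below a quarter of `|dist x y -
      -- r|` excludes it between the balls, since each endpoint moves by at most two radii.
      obtain ⟨n, hn⟩ := exists_nat_one_div_lt
        (lt_min (half_pos hr0) (div_pos hpos (by norm_num : (0 : ℝ) < 4)))
      obtain ⟨hn1, hn2⟩ := lt_min_iff.1 hn
      have hε : (0 : ℝ) < 1 / (n + 1) := by positivity
      obtain ⟨k, hk⟩ := hq x hx _ hε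
      obtain ⟨l, hl⟩ := hq y hy _ hε
      have hfar : ∀ u v : Urysohn, dist u (q k) ≤ 1 / ((n : ℝ) + 1) → dist v (q l) ≤ 1 / ((n : ℝ) + 1) →
          dist u v ≠ r := by
        intro u v hu hv h
        have h1 := dist_triangle4 x (q k) u v
        have h2 := dist_triangle4 x v (q l) y
        have h3 := dist_triangle4 u (q k) x y
        have h4 := dist_triangle4 u y (q l) v
        have h5 := dist_comm (q k) u
        have h6 := dist_comm (q l) y
        have h7 := dist_comm (q k) x
        have h8 := dist_comm (q l) v
        have h9 := dist_triangle x v y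
        have h10 := dist_triangle v (q l) y
        have h11 := dist_triangle u y v
        have h12 := dist_triangle y (q l) v
        have h13 : |dist x y - r| ≤ 4 * (1 / ((n : ℝ) + 1)) := by
          rw [abs_le]
          constructor <;> linarith
        linarith
      have hnear : ∀ p u v : Urysohn, dist u p ≤ 1 / ((n : ℝ) + 1) → dist v p ≤ 1 / ((n : ℝ) + 1) →
          dist u v ≠ r := by
        intro p u v hu hv h
        have h1 := dist_triangle_right u v p
        linarith
      let i : I := ⟨(k, l, n), by
        rintro u ⟨-, hu⟩ v ⟨-, hv⟩
        rcases hu with hu | hu <;> rcases hv with hv | hv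
        · exact hnear _ u v hu hv
        · exact hfar u v hu hv
        · rw [dist_comm]
          exact hfar v u hv hu
        · exact hnear _ u v hu hv⟩
      refine ⟨_, ⟨Sum.inl i, x, ⟨hx, Or.inl hk.le⟩, rfl⟩, _,
        ⟨Sum.inl i, y, ⟨hy, Or.inr hl.le⟩, rfl⟩, ?_⟩
      ext
      rw [coe_nndist, coe_nndist, hg.dist_eq, Wedge.dist_mk_same]
  · rintro ⟨_, i, x, hx, rfl⟩ hp t
    change (r : ℝ) ≤ dist (g _) (g _)
    rw [hg.dist_eq]
    by_cases hi : i = Sum.inr t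
    · subst hi
      rcases hx with rfl | rfl
      · rw [Wedge.dist_mk_same, hac']
      · exact absurd ⟨t, rfl⟩ hp
    · rw [Wedge.dist_mk_ne hi]
      refine le_max_of_le_right ?_
      simp [b, dist_comm c a, hac']
  · have hne : ∀ i, ∀ x ∈ P i, (∀ t, g (Wedge.mk b i x) ≠ E t) → ∀ y ∈ P i,
        (∀ t, g (Wedge.mk b i y) ≠ E t) → dist x y ≠ r := by
      rintro (k | t) x hx hxE y hy hyE
      · exact k.2 x hx y hy
      · rcases hx with rfl | rfl
        · rcases hy with rfl | rfl
          · rw [dist_self]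
            exact hr0.ne
          · exact absurd rfl (hyE t)
        · exact absurd rfl (hxE t)
    -- A distance between different copies is a distance to the base point inside one copy. As the
    -- base point is unmarked, `hne` covers this case too.
    have hbE : ∀ i t, g (Wedge.mk b i (b i)) ≠ E t := by
      intro i t h
      have h1 : dist (g (Wedge.mk b (Sum.inr t) c)) (g (Wedge.mk b i (b i))) = 0 := by
        rw [h, dist_self]
      rw [hg.dist_eq, Wedge.dist_mk_base, dist_comm] at h1
      exact hr0.ne' (hac'.symm.trans h1)
    rintro ⟨_, i, x, hx, rfl⟩ hp ⟨_, j, y, hy, rfl⟩ hq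
    have hp' : ∀ t, g (Wedge.mk b i x) ≠ E t := fun t h => hp ⟨t, Subtype.ext h.symm⟩
    have hq' : ∀ t, g (Wedge.mk b j y) ≠ E t := fun t h => hq ⟨t, Subtype.ext h.symm⟩
    change dist (g _) (g _) ≠ (r : ℝ)
    rw [hg.dist_eq]
    by_cases hij : i = j
    · subst hij
      rw [Wedge.dist_mk_same]
      exact hne _ x hx hp' y hy hq'
    · rw [Wedge.dist_mk_ne hij]
      rcases max_choice (dist x (b i)) (dist y (b j)) with h | h <;> rw [h]
      · exact hne _ x hx hp' _ (hb i) (hbE i)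
      · exact hne _ y hy hq' _ (hb j) (hbE j)

/-! ## Recovering a factor of a product -/

namespace MarkedPair

variable {K X Y : Type*} [MetricSpace K] [MetricSpace X] [MetricSpace Y] {r : ℝ} {e : Bool → K}

/-- Marked points are isolated at scale `r`; this is what makes a marked K-coordinate rigid. -/
theorem eq_of_dist_lt (he : MarkedPair r e) {p : K} {t : Bool} (h : dist p (e t) < r) :
    p = e t := by
  by_cases hp : p ∈ Set.range e
  · obtain ⟨s, rfl⟩ := hp
    by_contra hst
    exact h.ne (he.dist_eq s t fun h => hst (h ▸ rfl))
  · exact absurd h (he.le_dist p hp t).not_gt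

theorem dist_le (he : MarkedPair r e) (s t : Bool) : dist (e s) (e t) ≤ r := by
  by_cases hst : s = t
  · rw [hst, dist_self]
    exact he.pos.le
  · exact (he.dist_eq s t hst).le

/-- The two images are at distance `r`, which neither `Y` nor the unmarked part of `K` realizes. -/
theorem exists_snd_mem_range (he : MarkedPair r e) (hY : ∀ y y' : Y, dist y y' ≠ r)
    {φ : X × K → Y × K} (hφ : Isometry φ) (x : X) : ∃ t, (φ (x, e t)).2 ∈ Set.range e := by
  by_contra! h
  have h1 := hφ.dist_eq (x, e true) (x, e false)
  rw [Prod.dist_eq, Prod.dist_eq, dist_self, max_eq_right dist_nonneg,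
    he.dist_eq _ _ (by simp)] at h1
  rcases max_choice (dist (φ (x, e true)).1 (φ (x, e false)).1)
    (dist (φ (x, e true)).2 (φ (x, e false)).2) with h2 | h2 <;> rw [h2] at h1
  · exact hY _ _ h1
  · exact he.dist_ne _ (h _) _ (h _) h1

theorem exists_fiber_isometry (he : MarkedPair r e) (hX : ∀ x x' : X, dist x x' ≠ r)
    (hY : ∀ y y' : Y, dist y y' ≠ r) {φ : X × K → Y × K} (hφ : Isometry φ) :
    ∃ (τ : X → Bool) (g : X → Y), Isometry g ∧
      (∀ x, ∃ s, φ (x, e (τ x)) = (g x, e s)) ∧ ∀ x x', dist x x' < r → τ x = τ x' := by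
  classical
  have hloc : ∀ x x' t, dist x x' < r → (φ (x', e t)).2 ∈ Set.range e →
      (φ (x, e t)).2 = (φ (x', e t)).2 := by
    rintro x x' t hd ⟨s, hs⟩
    have h1 := hφ.dist_eq (x, e t) (x', e t)
    rw [Prod.dist_eq, Prod.dist_eq, dist_self, max_eq_left dist_nonneg] at h1
    rw [← hs]
    refine he.eq_of_dist_lt ?_
    rw [hs]
    exact (le_max_right _ _).trans_lt (h1.trans_lt hd)
  -- Both choices may be admissible. Preferring `true` whenever possible makes the choice constant
  -- at scale `r`, because by `hloc` admissibility is.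
  let τ : X → Bool := fun x => decide ((φ (x, e true)).2 ∈ Set.range e)
  have hτ : ∀ x x', dist x x' < r → τ x = τ x' := by
    intro x x' hd
    refine decide_eq_decide.2 ⟨fun h => ?_, fun h => ?_⟩
    · rwa [hloc x' x true (by rwa [dist_comm]) h]
    · rwa [hloc x x' true hd h]
  have hmem : ∀ x, (φ (x, e (τ x))).2 ∈ Set.range e := by
    intro x
    obtain ⟨t, ht⟩ := he.exists_snd_mem_range hY hφ x
    by_cases h : (φ (x, e true)).2 ∈ Set.range e
    · rwa [show τ x = true from decide_eq_true h]
    · rw [show τ x = false from decide_eq_false h]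
      cases t
      · exact ht
      · exact absurd ht h
  choose s hs using hmem
  refine ⟨τ, fun x => (φ (x, e (τ x))).1, Isometry.of_dist_eq fun x x' => ?_,
    fun x => ⟨s x, Prod.ext rfl (hs x).symm⟩, hτ⟩
  have h1 := hφ.dist_eq (x, e (τ x)) (x', e (τ x'))
  rw [Prod.dist_eq, Prod.dist_eq] at h1
  simp only at h1
  -- Below `r` the marked coordinates of the images coincide. Above `r` they differ by at most `r`.
  -- Either way the maximum is attained in `Y`.
  rcases (hX x x').lt_or_gt with hd | hd
  · rw [← hτ x x' hd] at h1 ⊢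
    rwa [dist_self, max_eq_left dist_nonneg, hloc x x' _ hd (by rw [hτ x x' hd]; exact ⟨_, hs x'⟩),
      dist_self, max_eq_left dist_nonneg] at h1
  · rw [max_eq_left ((he.dist_le _ _).trans hd.le), ← hs, ← hs] at h1
    rcases max_choice (dist (φ (x, e (τ x))).1 (φ (x', e (τ x'))).1) (dist (e (s x)) (e (s x')))
      with h2 | h2 <;> rw [h2] at h1
    · exact h1
    · exact absurd hd ((h1 ▸ he.dist_le _ _).not_gt)

theorem nonempty_isometryEquiv (he : MarkedPair r e) (hX : ∀ x x' : X, dist x x' ≠ r)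
    (hY : ∀ y y' : Y, dist y y' ≠ r) (φ : X × K ≃ᵢ Y × K) : Nonempty (X ≃ᵢ Y) := by
  obtain ⟨τ, g, hg, hφg, hτ⟩ := he.exists_fiber_isometry hX hY φ.isometry
  have hsurj : Function.Surjective g := by
    intro y
    obtain ⟨f, t, ht⟩ := he.exists_snd_mem_range hX φ.symm.isometry y
    set x := (φ.symm (y, e f)).1
    have hx : φ (x, e t) = (y, e f) := by
      rw [ht, Prod.mk.eta, φ.apply_symm_apply]
    obtain ⟨s, hs⟩ := hφg x
    -- If `t` is the choice not made at `x`, then `g x` may differ from `y`, but it is within `r` of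
    -- it, and strictly so because `Y` omits `r`.
    by_cases hst : t = τ x
    · rw [hst, hs] at hx
      exact ⟨x, congrArg Prod.fst hx⟩
    have h1 : dist y (g x) ≤ r := by
      have h2 := φ.isometry.dist_eq (x, e t) (x, e (τ x))
      rw [hx, hs, Prod.dist_eq, Prod.dist_eq, dist_self, max_eq_right dist_nonneg,
        he.dist_eq _ _ hst] at h2
      exact (le_max_left _ _).trans h2.le
    -- Moving from `(g x, e s)` to `(y, e s)` is thus shorter than `r`, so the preimage keeps the
    -- K-coordinate `e (τ x)` and lies over a point with the same choice. That point is sent to `y`.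
    have h2 := φ.symm.isometry.dist_eq (y, e s) (g x, e s)
    rw [← hs, φ.symm_apply_apply, hs, Prod.dist_eq, Prod.dist_eq, dist_self,
      max_eq_left dist_nonneg] at h2
    have h3 := h2.trans_lt (h1.lt_of_ne (hY _ _))
    have h4 := he.eq_of_dist_lt ((le_max_right _ _).trans_lt h3)
    have h5 := hτ _ _ ((le_max_left _ _).trans_lt h3)
    obtain ⟨s', hs'⟩ := hφg (φ.symm (y, e s)).1
    refine ⟨(φ.symm (y, e s)).1, ?_⟩
    rw [h5, ← h4, Prod.mk.eta, φ.apply_symm_apply] at hs'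
    exact (congrArg Prod.fst hs').symm
  exact ⟨IsometryEquiv.mk (Equiv.ofBijective g ⟨hg.injective, hsurj⟩) hg⟩

end MarkedPair

/-! ## Products inside the Urysohn space -/

theorem nndist_prod {V W : Type*} [PseudoMetricSpace V] [PseudoMetricSpace W] (p q : V × W) :
    nndist p q = max (nndist p.1 q.1) (nndist p.2 q.2) := rfl

section Product

variable {U : Type*} [MetricSpace U] [CompleteSpace U] {j : U × U → U} (hj : Isometry j)

/-- The copy of the product of two closed sets (with the maximum metric) provided by `j`. -/
def closedProd (K X : NonemptyClosed U) : NonemptyClosed U where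
  carrier := j '' (X.carrier ×ˢ K.carrier)
  isClosed := hj.isClosedEmbedding.isClosedMap _ (X.isClosed.prod K.isClosed)
  nonempty := (X.nonempty.prod K.nonempty).image j

/-- The product meets `V` exactly when `X` meets the union of the slices of the preimage of `V` over
points of `K`, and this union is open. -/
theorem measurable_closedProd (K : NonemptyClosed U) : Measurable (closedProd hj K) := by
  refine measurable_generateFrom ?_
  rintro _ ⟨V, hV, rfl⟩
  refine MeasurableSpace.measurableSet_generateFrom
    ⟨{x | ∃ k ∈ K.carrier, j (x, k) ∈ V}, ?_, ?_⟩
  · rw [show {x | ∃ k ∈ K.carrier, j (x, k) ∈ V} = ⋃ k ∈ K.carrier, (fun x => j (x, k)) ⁻¹' V by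
      ext; simp]
    exact isOpen_biUnion fun k _ =>
      hV.preimage (hj.continuous.comp (Continuous.prodMk_left k))
  · ext X
    constructor
    · rintro ⟨_, ⟨⟨x, k⟩, ⟨hx, hk⟩, rfl⟩, hv⟩
      exact ⟨x, hx, k, hk, hv⟩
    · rintro ⟨x, hx, k, hk, hv⟩
      exact ⟨_, ⟨(x, k), ⟨hx, hk⟩, rfl⟩, hv⟩

/-- The product is isometric to its copy. -/
noncomputable def closedProdEquiv (K X : NonemptyClosed U) :
    X.carrier × K.carrier ≃ᵢ (closedProd hj K X).carrier :=
  IsometryEquiv.mk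
    (Equiv.ofBijective (fun p => ⟨j (p.1, p.2), (p.1.1, p.2.1), ⟨p.1.2, p.2.2⟩, rfl⟩) (by
      constructor
      · intro p q h
        have h1 := hj.injective (congrArg Subtype.val h)
        exact Prod.ext (Subtype.ext (congrArg Prod.fst h1)) (Subtype.ext (congrArg Prod.snd h1))
      · rintro ⟨_, ⟨x, k⟩, ⟨hx, hk⟩, rfl⟩
        exact ⟨(⟨x, hx⟩, ⟨k, hk⟩), rfl⟩))
    (Isometry.of_dist_eq fun p q => hj.dist_eq _ _)

theorem distanceSet_closedProd {K X : NonemptyClosed U}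
    (h : distanceSet X.carrier ⊆ distanceSet K.carrier) :
    distanceSet (closedProd hj K X).carrier = distanceSet K.carrier := by
  ext d
  constructor
  · rintro ⟨_, ⟨⟨x, k⟩, ⟨hx, hk⟩, rfl⟩, _, ⟨⟨y, l⟩, ⟨hy, hl⟩, rfl⟩, rfl⟩
    rw [hj.nndist_eq, nndist_prod]
    rcases max_choice (nndist x y) (nndist k l) with hm | hm
    · exact h ⟨x, hx, y, hy, hm.symm⟩
    · exact ⟨k, hk, l, hl, hm.symm⟩
  · rintro ⟨k, hk, l, hl, rfl⟩
    obtain ⟨x, hx⟩ := X.nonempty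
    refine ⟨_, ⟨(x, k), ⟨hx, hk⟩, rfl⟩, _, ⟨(x, l), ⟨hx, hl⟩, rfl⟩, ?_⟩
    simp [hj.nndist_eq, nndist_prod]

theorem MarkedPair.isometric_closedProd {K X Y : NonemptyClosed U} {r : ℝ} {e : Bool → K.carrier}
    (he : MarkedPair r e) (hX : ∀ x x' : X.carrier, dist x x' ≠ r)
    (hY : ∀ y y' : Y.carrier, dist y y' ≠ r) :
    Isometric X Y ↔ Isometric (closedProd hj K X) (closedProd hj K Y) := by
  constructor
  · rintro ⟨φ⟩
    exact ⟨(closedProdEquiv hj K X).symm.trans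
      ((IsometryEquiv.mk (φ.toEquiv.prodCongr (Equiv.refl _))
        (φ.isometry.prodMap isometry_id)).trans (closedProdEquiv hj K Y))⟩
  · rintro ⟨φ⟩
    exact he.nonempty_isometryEquiv hX hY
      ((closedProdEquiv hj K X).trans (φ.trans (closedProdEquiv hj K Y).symm))

theorem MarkedPair.isometricallyEmbeds_closedProd {K X Y : NonemptyClosed U} {r : ℝ}
    {e : Bool → K.carrier} (he : MarkedPair r e) (hX : ∀ x x' : X.carrier, dist x x' ≠ r)
    (hY : ∀ y y' : Y.carrier, dist y y' ≠ r) :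
    IsometricallyEmbeds X Y ↔ IsometricallyEmbeds (closedProd hj K X) (closedProd hj K Y) := by
  constructor
  · rintro ⟨φ, hφ⟩
    exact ⟨_, (closedProdEquiv hj K Y).isometry.comp
      ((hφ.prodMap isometry_id).comp (closedProdEquiv hj K X).symm.isometry)⟩
  · rintro ⟨φ, hφ⟩
    obtain ⟨-, g, hg, -⟩ := he.exists_fiber_isometry hX hY
      ((closedProdEquiv hj K Y).symm.isometry.comp (hφ.comp (closedProdEquiv hj K X).isometry))
    exact ⟨g, hg⟩

end Product

/-! ## Borel reductions -/

theorem BorelReducible.refl {X : Type*} [MeasurableSpace X] (R : X → X → Prop) :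
    BorelReducible R R := ⟨id, measurable_id, fun _ _ => Iff.rfl⟩

theorem BorelReducible.trans {X Y Z : Type*} [MeasurableSpace X] [MeasurableSpace Y]
    [MeasurableSpace Z] {R : X → X → Prop} {S : Y → Y → Prop} {T : Z → Z → Prop}
    (hRS : BorelReducible R S) (hST : BorelReducible S T) : BorelReducible R T := by
  obtain ⟨f, hf, hfR⟩ := hRS
  obtain ⟨g, hg, hgS⟩ := hST
  exact ⟨g ∘ f, hg.comp hf, fun x x' => (hfR x x').trans (hgS _ _)⟩

theorem isomExactly_reducible_isomWithin (A : Set ℝ≥0) :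
    BorelReducible (isomExactly A) (isomWithin A) :=
  ⟨fun C => ⟨C.1, (show distanceSet C.1.carrier = A from C.2).subset⟩,
    measurable_subtype_coe.subtype_mk, fun _ _ => Iff.rfl⟩

theorem embExactly_reducible_embWithin (A : Set ℝ≥0) :
    BorelReducible (embExactly A) (embWithin A) :=
  ⟨fun C => ⟨C.1, (show distanceSet C.1.carrier = A from C.2).subset⟩,
    measurable_subtype_coe.subtype_mk, fun _ _ => Iff.rfl⟩

/-- A single Borel map reduces both relations on the spaces with distances in `A` to the
corresponding relations on the spaces with distance set `A'`. -/
theorem exists_reduction_within_exactly {A A' : Set ℝ≥0} (hA : Realizable A)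
    (hA' : Realizable A') (h : A ⊂ A') :
    ∃ f : SpacesWithin A → SpacesExactly A', Measurable f ∧
      (∀ C C', isomWithin A C C' ↔ isomExactly A' (f C) (f C')) ∧
      ∀ C C', embWithin A C C' ↔ embExactly A' (f C) (f C') := by
  obtain ⟨r, hrA', hrA⟩ := Set.exists_of_ssubset h
  obtain ⟨D, rfl : distanceSet D.carrier = A⟩ := hA
  obtain ⟨C, rfl : distanceSet C.carrier = A'⟩ := hA'
  have hr : r ≠ 0 := by
    rintro rfl
    obtain ⟨x, hx⟩ := D.nonempty
    exact hrA ⟨x, hx, x, hx, nndist_self x⟩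
  obtain ⟨K, hKC, e, he⟩ := exists_markedPair C hr hrA'
  have := isUrysohn_urysohn.separable
  -- A single embedding of the square serves all `X` at once, so no choice depending on `X` can
  -- spoil measurability.
  obtain ⟨j, hj⟩ := isUrysohn_urysohn.exists_isometry (Urysohn × Urysohn)
  have hne : ∀ X : SpacesWithin (distanceSet D.carrier), ∀ x x' : X.1.carrier,
      dist x x' ≠ (r : ℝ) := fun X x x' hd =>
    hrA (X.2 ⟨x, x.2, x', x'.2, NNReal.coe_injective hd⟩)
  refine ⟨fun X => ⟨closedProd hj K X.1, ?_⟩, ?_, fun X Y => ?_, fun X Y => ?_⟩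
  · exact (distanceSet_closedProd hj ((X.2.trans h.subset).trans hKC.superset)).trans hKC
  · exact ((measurable_closedProd hj K).comp measurable_subtype_coe).subtype_mk
  · exact he.isometric_closedProd hj (hne X) (hne Y)
  · exact he.isometricallyEmbeds_closedProd hj (hne X) (hne Y)

theorem mainTheorem12 (A A' : Set ℝ≥0) (hA : Realizable A) (hA' : Realizable A') :
    (A ⊂ A' →
      (BorelReducible (isomExactly A) (isomWithin A) ∧
        BorelReducible (isomWithin A) (isomExactly A') ∧
        BorelReducible (isomExactly A') (isomWithin A')) ∧
      (BorelReducible (embExactly A) (embWithin A) ∧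
        BorelReducible (embWithin A) (embExactly A') ∧
        BorelReducible (embExactly A') (embWithin A'))) ∧
    (A ⊆ A' → BorelReducible (isomExactly A) (isomExactly A')) := by
  have key : A ⊂ A' → BorelReducible (isomWithin A) (isomExactly A') ∧
      BorelReducible (embWithin A) (embExactly A') := fun h => by
    obtain ⟨f, hf, hf1, hf2⟩ := exists_reduction_within_exactly hA hA' h
    exact ⟨⟨f, hf, hf1⟩, ⟨f, hf, hf2⟩⟩
  refine ⟨fun h => ⟨⟨isomExactly_reducible_isomWithin A, (key h).1,
    isomExactly_reducible_isomWithin A'⟩, embExactly_reducible_embWithin A, (key h).2,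
    embExactly_reducible_embWithin A'⟩, fun h => ?_⟩
  rcases h.eq_or_ssubset with rfl | h
  · exact BorelReducible.refl _
  · exact (isomExactly_reducible_isomWithin A).trans (key h).1
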